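/- Let $k$ be a field, $R=k[x_1,\dots,x_n]$, and let $I\subseteq R$ be an ideal. For $\omega\in\mathbb{R}^n$ and $f\in R$ let the initial form $\mathrm{in}_\omega(f)$ be the sum of all terms of $f$ whose exponent vectors maximize $\langle\omega,\cdot\rangle$ among the exponent vectors of $f$ (with $\mathrm{in}_\omega(0)=0$), and let $\mathrm{in}_\omega(I)=\langle \mathrm{in}_\omega(f) : f\in I\rangle$. Call $u,v\in\mathbb{R}^n$ equivalent if $\mathrm{in}_u(I)=\mathrm{in}_v(I)$. A face of a set $P\subseteq\mathbb{R}^n$ is either the empty set or a non-empty subset of $P$ that is the set of maximizers over $P$ of a linear form. The Gröbner fan of $I$ is the set consisting of the closures in $\mathbb{R}^n$ of all equivalence classes that meet the positive orthant $\mathbb{R}_{>0}^n$, together with the non-empty proper faces of these closures. Let $C_1$ and $C_2$ be two cones in the Gröbner fan of $I$. Then the intersection $C_1\cap C_2$ is a face of $C_1$. -/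

import Mathlib

noncomputable section

namespace GroebnerFan

variable {n : ℕ} {k : Type*} [Field k]

/-- The `ω`-degree `⟨ω, α⟩` of the monomial with exponent vector `α`. -/
def wdeg (ω : Fin n → ℝ) (α : Fin n →₀ ℕ) : ℝ :=
  ∑ i, ω i * (α i : ℝ)

open Classical in
/-- The initial form `in_ω(f)`: the sum of all terms of `f` whose exponents maximize `⟨ω, ·⟩`
among the exponents of `f` (it is `0` for `f = 0`). -/
def initialForm (ω : Fin n → ℝ) (f : MvPolynomial (Fin n) k) : MvPolynomial (Fin n) k :=
  ∑ α ∈ f.support with ∀ β ∈ f.support, wdeg ω β ≤ wdeg ω α, MvPolynomial.monomial α (f.coeff α)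

/-- The initial ideal `in_ω(I)`, generated by the initial forms `in_ω(f)` of all `f ∈ I`. -/
def initialIdeal (ω : Fin n → ℝ) (I : Ideal (MvPolynomial (Fin n) k)) :
    Ideal (MvPolynomial (Fin n) k) :=
  Ideal.span (initialForm ω '' (I : Set (MvPolynomial (Fin n) k)))

/-- The equivalence class of `v` under `u ∼ v ↔ in_u(I) = in_v(I)`, a subset of `ℝⁿ`. -/
def equivClass (I : Ideal (MvPolynomial (Fin n) k)) (v : Fin n → ℝ) : Set (Fin n → ℝ) :=
  {u | initialIdeal u I = initialIdeal v I}

/-- `C_v(I)`, the closure of the equivalence class of `v` in the usual topology of `ℝⁿ`. -/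
def closedClass (I : Ideal (MvPolynomial (Fin n) k)) (v : Fin n → ℝ) : Set (Fin n → ℝ) :=
  closure (equivClass I v)

/-- `F` is a face of `P ⊆ ℝⁿ`: either `F` is empty, or it is the non-empty set of maximizers over
`P` of a linear form. This is Mathlib's notion of an exposed subset, where the linear form is an
element of the dual of `ℝⁿ`. -/
abbrev IsFace (P F : Set (Fin n → ℝ)) : Prop :=
  IsExposed ℝ P F

/-- The Gröbner fan of `I`: the closures of all equivalence classes that contain a vector with
strictly positive coordinates, together with their non-empty faces. (Each closure is a face of
itself, so it is a member.) -/
def groebnerFan (I : Ideal (MvPolynomial (Fin n) k)) : Set (Set (Fin n → ℝ)) :=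
  {F | F.Nonempty ∧ ∃ v : Fin n → ℝ, (∀ i, 0 < v i) ∧ IsFace (closedClass I v) F}

end GroebnerFan

end

/-! ### Weighted degrees and initial forms. -/

namespace GroebnerFan

open MvPolynomial

variable {n : ℕ} {k : Type*} [Field k]

/-! For positive `v`, take a reduced Gröbner basis for the order by `v`-degree with lexicographic
tie-break. The weights under which its leading exponents stay maximal form a polyhedral cone, and
the classes meeting it are exactly the relative interiors of its faces (`initialIdeal_eq_iff`). So
every cone of the fan is closed, additive, a union of classes, and contained in such a polyhedral
cone (`exists_of_mem_groebnerFan`). All but the last property pass to intersections, so `C₁ ∩ C₂` is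
a closed additive union of relatively open faces of the polyhedral cone around `C₁`, hence a face of
it (`isExposed_of_saturated`) and therefore of `C₁`. The Gröbner bases belonging to `C₁` and `C₂`
are never compared. -/

lemma wdeg_eq_weight (ω : Fin n → ℝ) (α : Fin n →₀ ℕ) : wdeg ω α = Finsupp.weight ω α := by
  rw [Finsupp.weight_apply, Finsupp.sum_fintype _ _ (by simp), wdeg]
  simp [mul_comm]

lemma wdeg_add (ω : Fin n → ℝ) (α β : Fin n →₀ ℕ) : wdeg ω (α + β) = wdeg ω α + wdeg ω β := by
  simp [wdeg_eq_weight]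

/-- The part of `f` of `ω`-degree `c`, as a linear map in `f`. -/
noncomputable abbrev part (ω : Fin n → ℝ) (c : ℝ) : MvPolynomial (Fin n) k →ₗ[k] MvPolynomial (Fin n) k :=
  weightedHomogeneousComponent ω c

open Classical in
lemma coeff_part (ω : Fin n → ℝ) (c : ℝ) (f : MvPolynomial (Fin n) k) (α : Fin n →₀ ℕ) :
    coeff α (part ω c f) = if wdeg ω α = c then coeff α f else 0 := by
  rw [coeff_weightedHomogeneousComponent, wdeg_eq_weight]

open Classical in
lemma coeff_initialForm (ω : Fin n → ℝ) (f : MvPolynomial (Fin n) k) (α : Fin n →₀ ℕ) :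
    coeff α (initialForm ω f)
      = if ∀ β ∈ f.support, wdeg ω β ≤ wdeg ω α then coeff α f else 0 := by
  simp only [initialForm, coeff_sum, coeff_monomial, Finset.sum_ite_eq', Finset.mem_filter,
    mem_support_iff]
  by_cases h : coeff α f = 0 <;> simp [h]

lemma mem_support_initialForm {ω : Fin n → ℝ} {f : MvPolynomial (Fin n) k} {α : Fin n →₀ ℕ} :
    α ∈ (initialForm ω f).support ↔ α ∈ f.support ∧ ∀ β ∈ f.support, wdeg ω β ≤ wdeg ω α := by
  simp only [mem_support_iff, coeff_initialForm]
  split_ifs with h <;> simp_all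

lemma initialForm_eq_part {ω : Fin n → ℝ} {f : MvPolynomial (Fin n) k} {α : Fin n →₀ ℕ}
    (hα : α ∈ f.support) (h : ∀ β ∈ f.support, wdeg ω β ≤ wdeg ω α) :
    initialForm ω f = part ω (wdeg ω α) f := by
  ext β
  rw [coeff_initialForm, coeff_part]
  by_cases hβ : β ∈ f.support
  · have : (∀ γ ∈ f.support, wdeg ω γ ≤ wdeg ω β) ↔ wdeg ω β = wdeg ω α :=
      ⟨fun H => le_antisymm (h β hβ) (H α hα), fun H => H ▸ h⟩
    simp only [this]
  · simp [notMem_support_iff.1 hβ]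

lemma exists_wdeg_max (ω : Fin n → ℝ) {f : MvPolynomial (Fin n) k} (hf : f ≠ 0) :
    ∃ α ∈ f.support, ∀ β ∈ f.support, wdeg ω β ≤ wdeg ω α :=
  f.support.exists_max_image _ (Finset.nonempty_of_ne_empty (by simpa using hf))

lemma initialForm_ne_zero (ω : Fin n → ℝ) {f : MvPolynomial (Fin n) k} (hf : f ≠ 0) :
    initialForm ω f ≠ 0 := by
  obtain ⟨α, hα, h⟩ := exists_wdeg_max ω hf
  intro h0
  have := mem_support_initialForm.2 ⟨hα, h⟩
  simp [h0] at this

lemma initialForm_zero (ω : Fin n → ℝ) : initialForm ω (0 : MvPolynomial (Fin n) k) = 0 := by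
  simp [initialForm]

lemma part_monomial_mul (ω : Fin n → ℝ) (c : ℝ) (δ : Fin n →₀ ℕ) (a : k)
    (f : MvPolynomial (Fin n) k) :
    part ω c (monomial δ a * f) = monomial δ a * part ω (c - wdeg ω δ) f := by
  ext α
  rw [coeff_part, coeff_monomial_mul', coeff_monomial_mul', coeff_part]
  by_cases h : δ ≤ α
  · obtain ⟨γ, rfl⟩ := exists_add_of_le h
    have : wdeg ω (δ + γ) = c ↔ wdeg ω γ = c - wdeg ω δ := by
      rw [wdeg_add, eq_sub_iff_add_eq']
    simp only [this, h, if_true, add_tsub_cancel_left]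
    split_ifs <;> simp
  · simp [h]

lemma mem_support_monomial_mul {δ γ : Fin n →₀ ℕ} {a : k} {f : MvPolynomial (Fin n) k}
    (h : γ ∈ (monomial δ a * f).support) : ∃ γ' ∈ f.support, γ = δ + γ' := by
  rw [mem_support_iff, coeff_monomial_mul'] at h
  by_cases hd : δ ≤ γ
  · obtain ⟨γ', rfl⟩ := exists_add_of_le hd
    rw [if_pos hd, add_tsub_cancel_left] at h
    exact ⟨γ', mem_support_iff.2 (right_ne_zero_of_mul h), rfl⟩
  · simp [hd] at h

/-! ### Division and reduced Gröbner bases. -/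

/-- Division: if every monomial in `M ∩ D` is the leading term of an element of `J` whose other
terms are smaller and stay in `D`, then every polynomial with exponents in `D` reduces modulo `J`
to one with exponents in `D` and outside of `M`. -/
lemma mem_sup_restrictSupport {r : (Fin n →₀ ℕ) → (Fin n →₀ ℕ) → Prop} (wf : WellFounded r)
    {M D : Set (Fin n →₀ ℕ)} {J : Submodule k (MvPolynomial (Fin n) k)}
    (h : ∀ α ∈ M, α ∈ D → ∃ f ∈ J, coeff α f = 1 ∧ ∀ γ ∈ f.support, γ ≠ α → r γ α ∧ γ ∈ D)
    {f : MvPolynomial (Fin n) k} (hf : ∀ α ∈ f.support, α ∈ D) :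
    f ∈ J ⊔ restrictSupport k (Mᶜ ∩ D) := by
  have key : ∀ α, α ∈ D → monomial α (1 : k) ∈ J ⊔ restrictSupport k (Mᶜ ∩ D) := by
    intro α
    induction α using wf.induction with
    | _ α ih =>
      intro hα
      by_cases hM : α ∈ M
      · obtain ⟨p, hp, h1, h2⟩ := h α hM hα
        have hsum : monomial α (1 : k) = p - ∑ γ ∈ p.support.erase α, monomial γ (coeff γ p) := by
          rw [eq_sub_iff_add_eq]
          conv_rhs => rw [p.as_sum]
          rw [← Finset.add_sum_erase p.support _ (mem_support_iff.2 (h1 ▸ one_ne_zero)), h1]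
        rw [hsum]
        refine sub_mem (Submodule.mem_sup_left hp) (sum_mem fun γ hγ => ?_)
        obtain ⟨h3, h4⟩ := Finset.mem_erase.1 hγ
        obtain ⟨h5, h6⟩ := h2 γ h4 h3
        simpa [smul_monomial] using Submodule.smul_mem _ (coeff γ p) (ih γ h5 h6)
      · exact Submodule.mem_sup_right ((monomial_mem_restrictSupport k).2 (Or.inl ⟨hM, hα⟩))
  rw [f.as_sum]
  refine sum_mem fun α hα => ?_
  simpa [smul_monomial] using Submodule.smul_mem _ (coeff α f) (key α (hf α hα))

/-- A reduced Gröbner basis of `I`: the elements `g β` for `β` in the finite set `B`, with respect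
to a term order `r` whose set of leading exponents in `I` is `M`. -/
structure ReducedBasis (I : Ideal (MvPolynomial (Fin n) k)) where
  r : (Fin n →₀ ℕ) → (Fin n →₀ ℕ) → Prop
  wf : WellFounded r
  add_left : ∀ δ α β, r α β → r (δ + α) (δ + β)
  M : Set (Fin n →₀ ℕ)
  eq_zero : ∀ f ∈ I, (∀ α ∈ f.support, α ∉ M) → f = 0
  B : Finset (Fin n →₀ ℕ)
  exists_le : ∀ α ∈ M, ∃ β ∈ B, β ≤ α
  g : (Fin n →₀ ℕ) → MvPolynomial (Fin n) k
  g_mem : ∀ β ∈ B, g β ∈ I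
  coeff_g : ∀ β ∈ B, coeff β (g β) = 1
  g_lt : ∀ β ∈ B, ∀ γ ∈ (g β).support, γ ≠ β → r γ β
  g_reduced : ∀ β ∈ B, ∀ γ ∈ (g β).support, γ ≠ β → γ ∉ M

/-- Existence of reduced Gröbner bases, for an order given by an injective additive map `φ`. -/
lemma exists_reducedBasis {L : Type*} [AddCommMonoid L] [LinearOrder L]
    [IsOrderedCancelAddMonoid L] (φ : (Fin n →₀ ℕ) →+ L) (hφ : Function.Injective φ)
    (wf : WellFounded fun α β => φ α < φ β) (I : Ideal (MvPolynomial (Fin n) k)) :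
    ∃ G : ReducedBasis I, G.r = fun α β => φ α < φ β := by
  let M : Set (Fin n →₀ ℕ) := {α | ∃ f ∈ I, coeff α f = 1 ∧ ∀ γ ∈ f.support, γ ≠ α → φ γ < φ α}
  have hg : ∀ α ∈ M, ∃ p ∈ I, coeff α p = 1 ∧
      ∀ γ ∈ p.support, γ ≠ α → φ γ < φ α ∧ γ ∉ M := by
    intro α hα
    -- Here `q` is the normal form of the monomial `α`, so `p`, the monomial minus `q`, is monic
    -- with reduced tail; this `D` keeps the tail below `α`.
    obtain ⟨p, hp, q, hq, hpq⟩ := Submodule.mem_sup.1 <|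
      mem_sup_restrictSupport (k := k) wf (M := M) (D := {γ | φ γ ≤ φ α})
      (J := I.restrictScalars k) (f := monomial α 1)
      (fun β ⟨f, hf, h1, h2⟩ hβ' =>
        ⟨f, hf, h1, fun γ hγ hne => ⟨h2 γ hγ hne, (h2 γ hγ hne).le.trans hβ'⟩⟩)
      (fun β hβ => by
        obtain rfl : α = β := by
          by_contra hne
          simp [mem_support_iff, coeff_monomial, hne] at hβ
        exact le_rfl)
    have hq' : ∀ γ ∈ q.support, γ ∉ M ∧ φ γ ≤ φ α := fun γ hγ => (mem_restrictSupport_iff k).1 hq hγ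
    have hcoeff : ∀ γ, coeff γ p + coeff γ q = coeff γ (monomial α (1 : k)) := fun γ => by
      rw [← coeff_add, hpq]
    refine ⟨p, hp, ?_, fun γ hγ hne => ?_⟩
    · have h0 : coeff α q = 0 := by
        by_contra h
        exact (hq' α (mem_support_iff.2 h)).1 hα
      simpa [h0] using hcoeff α
    · have h0 : γ ∈ q.support := by
        rw [mem_support_iff] at hγ ⊢
        intro h
        have := hcoeff γ
        rw [coeff_monomial, if_neg hne.symm, h, add_zero] at this
        exact hγ this
      exact ⟨lt_of_le_of_ne (hq' γ h0).2 (hφ.ne hne), (hq' γ h0).1⟩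
  choose! g hg1 hg2 hg3 using hg
  -- Dickson's lemma.
  have hfin : {β | Minimal (· ∈ M) β}.Finite :=
    WellQuasiOrderedLE.finite_of_isAntichain (setOfPred_minimal_antichain _)
  refine ⟨⟨fun α β => φ α < φ β, wf, ?_, M, ?_, hfin.toFinset, ?_, g, ?_, ?_, ?_, ?_⟩, rfl⟩
  · intro δ α β h
    simpa using h
  · intro f hf h
    by_contra h0
    obtain ⟨α, hα, hmax⟩ := f.support.exists_max_image φ
      (Finset.nonempty_of_ne_empty (by simpa using h0))
    have hc := mem_support_iff.1 hα
    refine h α hα ⟨C (coeff α f)⁻¹ * f, I.mul_mem_left _ hf, by simp [hc], fun γ hγ hne => ?_⟩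
    refine lt_of_le_of_ne (hmax γ ?_) (hφ.ne hne)
    rw [mem_support_iff, coeff_C_mul] at hγ
    exact mem_support_iff.2 (right_ne_zero_of_mul hγ)
  · intro α hα
    obtain ⟨β, h1, h2⟩ := exists_minimal_le_of_wellFoundedLT (· ∈ M) α hα
    exact ⟨β, by simpa using h2, h1⟩
  all_goals
    intro β hβ
    have hβM : β ∈ M := (by simpa using hβ : Minimal (· ∈ M) β).prop
  · exact hg1 β hβM
  · exact hg2 β hβM
  · exact fun γ hγ hne => (hg3 β hβM γ hγ hne).1
  · exact fun γ hγ hne => (hg3 β hβM γ hγ hne).2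

/-! ### The term order refining a positive weight. -/

/-- The exponent vectors, ordered by `v`-degree with ties broken lexicographically. -/
noncomputable def refinedOrder (v : Fin n → ℝ) : (Fin n →₀ ℕ) →+ ℝ ×ₗ Lex (Fin n →₀ ℕ) where
  toFun α := toLex (wdeg v α, toLex α)
  map_zero' := by simp [wdeg_eq_weight]
  map_add' α β := by rw [wdeg_add]; rfl

lemma refinedOrder_injective (v : Fin n → ℝ) : Function.Injective (refinedOrder v) :=
  by
  intro α β h
  have h' : ofLex (refinedOrder v α) = ofLex (refinedOrder v β) := congrArg _ h
  exact congrArg (fun x => ofLex x.2) h'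

lemma wdeg_le_of_refinedOrder_lt {v : Fin n → ℝ} {α β : Fin n →₀ ℕ}
    (h : refinedOrder v α < refinedOrder v β) : wdeg v α ≤ wdeg v β := by
  rcases Prod.Lex.lt_iff.1 h with h | h
  · exact h.le
  · exact h.1.le

lemma finite_wdeg_le {v : Fin n → ℝ} (hv : ∀ i, 0 < v i) (c : ℝ) :
    {α : Fin n →₀ ℕ | wdeg v α ≤ c}.Finite := by
  refine (Set.finite_Iic (Finsupp.equivFunOnFinite.symm fun i => ⌊c / v i⌋₊)).subset ?_
  intro α hα i
  refine Nat.le_floor ((le_div_iff₀ (hv i)).2 ?_)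
  rw [mul_comm]
  exact (Finset.single_le_sum (f := fun i => v i * (α i : ℝ))
    (fun j _ => mul_nonneg (hv j).le (Nat.cast_nonneg _)) (Finset.mem_univ i)).trans hα

/-- Positivity of `v` leaves each exponent finitely many predecessors, and their number is a
strictly monotone rank. -/
lemma wellFounded_refinedOrder {v : Fin n → ℝ} (hv : ∀ i, 0 < v i) :
    WellFounded fun α β => refinedOrder v α < refinedOrder v β := by
  have hfin : ∀ β, {α | refinedOrder v α < refinedOrder v β}.Finite := fun β =>
    (finite_wdeg_le hv (wdeg v β)).subset fun α hα => wdeg_le_of_refinedOrder_lt hα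
  refine Subrelation.wf (r := InvImage (· < ·)
    fun β => {α | refinedOrder v α < refinedOrder v β}.ncard) ?_ (InvImage.wf _ wellFounded_lt)
  intro α β h
  refine Set.ncard_lt_ncard ⟨fun γ hγ => lt_trans hγ h, fun H => ?_⟩ (hfin β)
  exact lt_irrefl (refinedOrder v α) (H h)

/-! ### Initial ideals over the cone of a reduced basis. -/

namespace ReducedBasis

variable {I : Ideal (MvPolynomial (Fin n) k)} (G : ReducedBasis I)

/-- The closed cone of all `w` such that the leading exponents of the basis have maximal
`w`-degree. -/
def cone : Set (Fin n → ℝ) := {w | ∀ β ∈ G.B, ∀ γ ∈ (G.g β).support, wdeg w γ ≤ wdeg w β}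

lemma mem_support_g {β : Fin n →₀ ℕ} (hβ : β ∈ G.B) : β ∈ (G.g β).support :=
  mem_support_iff.2 (by simp [G.coeff_g β hβ])

/-- The span of the monomial multiples of basis elements with leading exponent in `D`. -/
noncomputable def shifts (D : Set (Fin n →₀ ℕ)) : Submodule k (MvPolynomial (Fin n) k) :=
  Submodule.span k {p | ∃ δ, ∃ β ∈ G.B, δ + β ∈ D ∧ p = monomial δ 1 * G.g β}

lemma shifts_le (D : Set (Fin n →₀ ℕ)) : G.shifts D ≤ I.restrictScalars k := by
  refine Submodule.span_le.2 ?_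
  rintro _ ⟨δ, β, hβ, -, rfl⟩
  exact I.mul_mem_left _ (G.g_mem β hβ)

lemma mem_shifts_sup {D : Set (Fin n →₀ ℕ)}
    (hD : ∀ δ, ∀ β ∈ G.B, δ + β ∈ D → ∀ γ ∈ (G.g β).support, δ + γ ∈ D)
    {f : MvPolynomial (Fin n) k} (hf : ∀ α ∈ f.support, α ∈ D) :
    f ∈ G.shifts D ⊔ restrictSupport k (G.Mᶜ ∩ D) := by
  refine mem_sup_restrictSupport G.wf (fun α hα hαD => ?_) hf
  obtain ⟨β, hβ, hle⟩ := G.exists_le α hα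
  obtain ⟨δ, rfl⟩ := exists_add_of_le hle
  rw [add_comm] at hαD ⊢
  refine ⟨_, Submodule.subset_span ⟨δ, β, hβ, hαD, rfl⟩, by simp [G.coeff_g β hβ], ?_⟩
  intro γ hγ hne
  obtain ⟨γ, hγ', rfl⟩ := mem_support_monomial_mul hγ
  exact ⟨G.add_left _ _ _ (G.g_lt β hβ γ hγ' fun h => hne (h ▸ rfl)), hD δ β hβ hαD γ hγ'⟩

/-- The remainder on division lies in `I` and avoids `M`, so it vanishes. -/
lemma mem_shifts {D : Set (Fin n →₀ ℕ)}
    (hD : ∀ δ, ∀ β ∈ G.B, δ + β ∈ D → ∀ γ ∈ (G.g β).support, δ + γ ∈ D)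
    {f : MvPolynomial (Fin n) k} (hI : f ∈ I) (hf : ∀ α ∈ f.support, α ∈ D) :
    f ∈ G.shifts D := by
  obtain ⟨p, hp, q, hq, rfl⟩ := Submodule.mem_sup.1 (G.mem_shifts_sup hD hf)
  have hqI : q ∈ I := (I.add_mem_iff_right (G.shifts_le D hp)).1 hI
  rw [G.eq_zero q hqI fun α hα => ((mem_restrictSupport_iff k).1 hq hα).1, add_zero]
  exact hp

variable {G} {w : Fin n → ℝ}

lemma initialForm_g (hw : w ∈ G.cone) {β : Fin n →₀ ℕ} (hβ : β ∈ G.B) :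
    initialForm w (G.g β) = part w (wdeg w β) (G.g β) :=
  initialForm_eq_part (G.mem_support_g hβ) (hw β hβ)

lemma part_eq_zero {c : ℝ} {f : MvPolynomial (Fin n) k} (h : ∀ α ∈ f.support, wdeg w α < c) :
    part w c f = 0 := by
  ext α
  rw [coeff_part]
  split_ifs with hc
  · by_contra h0
    exact (h α (mem_support_iff.2 h0)).ne hc
  · simp

/-- The initial forms of the basis generate the initial ideal. -/
lemma initialIdeal_eq (hw : w ∈ G.cone) :
    initialIdeal w I = Ideal.span ((fun β => initialForm w (G.g β)) '' G.B) := by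
  refine le_antisymm (Ideal.span_le.2 ?_) (Ideal.span_le.2 ?_)
  · rintro _ ⟨f, hf, rfl⟩
    rcases eq_or_ne f 0 with rfl | h0
    · rw [initialForm_zero]
      exact zero_mem _
    obtain ⟨α, hα, hmax⟩ := exists_wdeg_max w h0
    rw [initialForm_eq_part hα hmax]
    -- Reduction never raises the `w`-degree for `w` in the cone; termination comes from `G.r`, so
    -- `w` need not be positive.
    have hf' : f ∈ G.shifts {γ | wdeg w γ ≤ wdeg w α} :=
      G.mem_shifts (fun δ β hβ h γ hγ => by
        simp only [Set.mem_ofPred_eq, wdeg_add] at h ⊢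
        linarith [hw β hβ γ hγ]) hf hmax
    have hle : G.shifts {γ | wdeg w γ ≤ wdeg w α} ≤ ((Ideal.span
        ((fun β => initialForm w (G.g β)) '' G.B)).restrictScalars k).comap
          (part w (wdeg w α)) := by
      refine Submodule.span_le.2 ?_
      rintro _ ⟨δ, β, hβ, h, rfl⟩
      simp only [Submodule.comap_coe, Set.mem_preimage, part_monomial_mul]
      refine Ideal.mul_mem_left _ _ ?_
      rcases (show wdeg w β ≤ wdeg w α - wdeg w δ by
        simp only [Set.mem_ofPred_eq, wdeg_add] at h; linarith).eq_or_lt with h' | h'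
      · rw [← h', ← initialForm_g hw hβ]
        exact Ideal.subset_span ⟨β, hβ, rfl⟩
      · rw [part_eq_zero fun γ hγ => (hw β hβ γ hγ).trans_lt h']
        exact zero_mem _
    exact hle hf'
  · rintro _ ⟨β, hβ, rfl⟩
    exact Ideal.subset_span ⟨_, G.g_mem β hβ, rfl⟩

end ReducedBasis

/-- The homogeneous parts of elements of `in_w(I)` are top-degree parts of elements of `I`. -/
lemma exists_part_eq {w : Fin n → ℝ} {I : Ideal (MvPolynomial (Fin n) k)}
    {p : MvPolynomial (Fin n) k} (hp : p ∈ initialIdeal w I) :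
    ∀ c, ∃ f ∈ I, (∀ α ∈ f.support, wdeg w α ≤ c) ∧ part w c f = part w c p := by
  have hadd : ∀ p q : MvPolynomial (Fin n) k,
      (∀ c, ∃ f ∈ I, (∀ α ∈ f.support, wdeg w α ≤ c) ∧ part w c f = part w c p) →
      (∀ c, ∃ f ∈ I, (∀ α ∈ f.support, wdeg w α ≤ c) ∧ part w c f = part w c q) →
      ∀ c, ∃ f ∈ I, (∀ α ∈ f.support, wdeg w α ≤ c) ∧ part w c f = part w c (p + q) := by
    intro p q hp hq c
    obtain ⟨f, hf, h1, h2⟩ := hp c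
    obtain ⟨f', hf', h1', h2'⟩ := hq c
    refine ⟨f + f', add_mem hf hf', fun α hα => ?_, by rw [map_add, map_add, h2, h2']⟩
    rcases Finset.mem_union.1 (support_add hα) with h | h
    exacts [h1 α h, h1' α h]
  induction hp using Submodule.span_induction with
  | mem p hp =>
    obtain ⟨f, hf, rfl⟩ := hp
    intro c
    rcases eq_or_ne f 0 with rfl | h0
    · exact ⟨0, zero_mem _, by simp, by rw [initialForm_zero]⟩
    obtain ⟨α, hα, hmax⟩ := exists_wdeg_max w h0
    rw [initialForm_eq_part hα hmax]
    rcases eq_or_ne (wdeg w α) c with rfl | hne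
    · refine ⟨f, hf, hmax, ?_⟩
      ext γ
      simp only [coeff_part]
      split_ifs <;> rfl
    · refine ⟨0, zero_mem _, by simp, ?_⟩
      ext γ
      simp only [coeff_part, coeff_zero]
      split_ifs with h1 h2
      · exact absurd (h2.symm.trans h1) hne
      all_goals rfl
  | zero => exact fun c => ⟨0, zero_mem _, by simp, rfl⟩
  | add p q _ _ hp hq => exact hadd p q hp hq
  | smul a p _ hp =>
    rw [smul_eq_mul]
    induction a using MvPolynomial.induction_on' with
    | add a b ha hb =>
      rw [add_mul]
      exact hadd _ _ ha hb
    | monomial δ a =>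
      intro c
      obtain ⟨f, hf, h1, h2⟩ := hp (c - wdeg w δ)
      refine ⟨monomial δ a * f, I.mul_mem_left _ hf, fun α hα => ?_, ?_⟩
      · obtain ⟨γ, hγ, rfl⟩ := mem_support_monomial_mul hα
        rw [wdeg_add]
        linarith [h1 γ hγ]
      · rw [part_monomial_mul, part_monomial_mul, h2]

namespace ReducedBasis

variable {I : Ideal (MvPolynomial (Fin n) k)} {G : ReducedBasis I} {w u : Fin n → ℝ}

/-- The exponents outside of `M` are linearly independent modulo the initial ideal. -/
lemma eq_zero_of_mem_initialIdeal (hw : w ∈ G.cone) {p : MvPolynomial (Fin n) k}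
    (hp : p ∈ initialIdeal w I) (hM : ∀ α ∈ p.support, α ∉ G.M) : p = 0 := by
  ext α
  obtain ⟨f, hf, hle, hpart⟩ := exists_part_eq hp (wdeg w α)
  set c := wdeg w α
  have hcoeff : ∀ γ, wdeg w γ = c → coeff γ f = coeff γ p := fun γ hγ => by
    have := congrArg (coeff γ) hpart
    rwa [coeff_part, coeff_part, if_pos hγ, if_pos hγ] at this
  have hlow : ∀ γ ∈ (f - part w c f).support, wdeg w γ < c := by
    intro γ hγ
    rw [mem_support_iff, coeff_sub, coeff_part] at hγ
    split_ifs at hγ with h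
    · simp at hγ
    · exact lt_of_le_of_ne (hle γ (mem_support_iff.2 (by simpa using hγ))) h
  -- Reducing the lower-degree terms of `f` leaves an element of `I` with all exponents outside `M`.
  -- It is zero, and `q` cannot cancel anything in degree `c`.
  obtain ⟨j, hj, q, hq, hjq⟩ := Submodule.mem_sup.1 <|
    G.mem_shifts_sup (D := {γ | wdeg w γ < c}) (fun δ β hβ h γ hγ => by
      simp only [Set.mem_ofPred_eq, wdeg_add] at h ⊢
      linarith [hw β hβ γ hγ]) hlow
  have hq' : ∀ γ ∈ q.support, γ ∉ G.M ∧ wdeg w γ < c := fun γ hγ =>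
    (mem_restrictSupport_iff k).1 hq hγ
  have hrest : part w c f + q = f - j := by rw [← sub_eq_iff_eq_add'.2 hjq.symm]; ring
  have h0 : part w c f + q = 0 := by
    refine G.eq_zero _ (hrest ▸ sub_mem hf (G.shifts_le _ hj)) fun γ hγ => ?_
    rcases Finset.mem_union.1 (support_add hγ) with h | h
    · rw [mem_support_iff, coeff_part] at h
      split_ifs at h with hc
      · exact hM γ (mem_support_iff.2 (hcoeff γ hc ▸ h))
      · exact absurd rfl h
    · exact (hq' γ h).1
  have hqα : coeff α q = 0 := by
    by_contra h
    exact (hq' α (mem_support_iff.2 h)).2.false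
  have := congrArg (coeff α) h0
  rwa [coeff_add, hqα, add_zero, coeff_part, if_pos rfl, hcoeff α rfl] at this

/-- Both initial forms lie in `in_w(I)`, and `β` is the only exponent of `G.g β` that can lie in
`M`. Without `β` the `u`-form would vanish; with it, `β` cancels in the difference, which must then
vanish. -/
lemma initialForm_g_eq (hw : w ∈ G.cone) (h : initialIdeal u I = initialIdeal w I)
    {β : Fin n →₀ ℕ} (hβ : β ∈ G.B) :
    β ∈ (initialForm u (G.g β)).support ∧
      initialForm u (G.g β) = initialForm w (G.g β) := by
  have hg0 : G.g β ≠ 0 := fun h0 => by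
    simpa [h0] using G.coeff_g β hβ
  have hu : initialForm u (G.g β) ∈ initialIdeal w I :=
    h ▸ Ideal.subset_span ⟨_, G.g_mem β hβ, rfl⟩
  have hwm : initialForm w (G.g β) ∈ initialIdeal w I :=
    Ideal.subset_span ⟨_, G.g_mem β hβ, rfl⟩
  have hβu : β ∈ (initialForm u (G.g β)).support := by
    by_contra hnot
    refine initialForm_ne_zero u hg0 (eq_zero_of_mem_initialIdeal hw hu fun α hα => ?_)
    exact G.g_reduced β hβ α (mem_support_initialForm.1 hα).1 fun hαβ => hnot (hαβ ▸ hα)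
  have hβw : β ∈ (initialForm w (G.g β)).support :=
    mem_support_initialForm.2 ⟨G.mem_support_g hβ, hw β hβ⟩
  refine ⟨hβu, sub_eq_zero.1 (eq_zero_of_mem_initialIdeal hw (sub_mem hu hwm) fun α hα => ?_)⟩
  have hαβ : α ≠ β := by
    rintro rfl
    rw [mem_support_iff, coeff_sub, coeff_initialForm, coeff_initialForm,
      if_pos (mem_support_initialForm.1 hβu).2, if_pos (mem_support_initialForm.1 hβw).2] at hα
    simp at hα
  refine G.g_reduced β hβ α ?_ hαβ
  rcases Finset.mem_union.1 (support_sub _ _ _ hα) with h' | h'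
  exacts [(mem_support_initialForm.1 h').1, (mem_support_initialForm.1 h').1]

/-- Within the cone of a reduced basis, the class of `w` is given by linear conditions. -/
theorem initialIdeal_eq_iff (hw : w ∈ G.cone) : initialIdeal u I = initialIdeal w I ↔
    u ∈ G.cone ∧ ∀ β ∈ G.B, ∀ γ ∈ (G.g β).support, wdeg w γ = wdeg w β ↔ wdeg u γ = wdeg u β := by
  constructor
  · intro h
    have hu : u ∈ G.cone := fun β hβ => (mem_support_initialForm.1 (initialForm_g_eq hw h hβ).1).2
    refine ⟨hu, fun β hβ γ hγ => ?_⟩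
    have := congrArg (coeff γ) (initialForm_g_eq hw h hβ).2
    rw [initialForm_g hw hβ, initialForm_g hu hβ, coeff_part, coeff_part] at this
    rw [mem_support_iff] at hγ
    split_ifs at this <;> simp_all
  · rintro ⟨hu, h⟩
    rw [initialIdeal_eq hu, initialIdeal_eq hw]
    refine congrArg _ (Set.image_congr fun β hβ => ?_)
    rw [initialForm_g hw hβ, initialForm_g hu hβ]
    ext γ
    rw [coeff_part, coeff_part]
    by_cases hγ : γ ∈ (G.g β).support
    · simp only [h β hβ γ hγ]
    · simp [notMem_support_iff.1 hγ]

end ReducedBasis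

/-- The functional `u ↦ ⟨u, α⟩`. -/
noncomputable def wdegCLM (α : Fin n →₀ ℕ) : StrongDual ℝ (Fin n → ℝ) :=
  ∑ i, (α i : ℝ) • ContinuousLinearMap.proj i

lemma wdegCLM_apply (α : Fin n →₀ ℕ) (u : Fin n → ℝ) : wdegCLM α u = wdeg u α := by
  simp [wdegCLM, wdeg, mul_comm]

/-- The equivalence classes meeting a suitable polyhedral cone around a positive vector `v` are
the relative interiors of the faces of this cone. -/
theorem exists_finset_initialIdeal_eq_iff (I : Ideal (MvPolynomial (Fin n) k)) {v : Fin n → ℝ}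
    (hv : ∀ i, 0 < v i) : ∃ A : Finset (StrongDual ℝ (Fin n → ℝ)), (∀ a ∈ A, 0 ≤ a v) ∧
      ∀ w, (∀ a ∈ A, 0 ≤ a w) → ∀ u, initialIdeal u I = initialIdeal w I ↔
        (∀ a ∈ A, 0 ≤ a u) ∧ ∀ a ∈ A, a w = 0 ↔ a u = 0 := by
  classical
  obtain ⟨G, hG⟩ := exists_reducedBasis (refinedOrder v) (refinedOrder_injective v)
    (wellFounded_refinedOrder hv) I
  let A : Finset (StrongDual ℝ (Fin n → ℝ)) :=
    G.B.biUnion fun β => (G.g β).support.image fun γ => wdegCLM β - wdegCLM γ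
  have hA : ∀ P : StrongDual ℝ (Fin n → ℝ) → Prop, (∀ a ∈ A, P a) ↔
      ∀ β ∈ G.B, ∀ γ ∈ (G.g β).support, P (wdegCLM β - wdegCLM γ) := by
    intro P
    simp only [A, Finset.mem_biUnion, Finset.mem_image]
    exact ⟨fun h β hβ γ hγ => h _ ⟨β, hβ, γ, hγ, rfl⟩,
      by rintro h _ ⟨β, hβ, γ, hγ, rfl⟩; exact h β hβ γ hγ⟩
  have hcone : ∀ u, (∀ a ∈ A, 0 ≤ a u) ↔ u ∈ G.cone := fun u => by
    rw [hA]
    simp [wdegCLM_apply, ReducedBasis.cone]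
  refine ⟨A, (hcone v).2 fun β hβ γ hγ => ?_, fun w hw u => ?_⟩
  · rcases eq_or_ne γ β with rfl | hne
    · exact le_rfl
    · have := G.g_lt β hβ γ hγ hne
      rw [hG] at this
      exact wdeg_le_of_refinedOrder_lt this
  · rw [ReducedBasis.initialIdeal_eq_iff ((hcone w).1 hw), hcone, hA]
    simp only [sub_apply, wdegCLM_apply, sub_eq_zero, eq_comm]

end GroebnerFan
-- Faces of polyhedral cones.
section Polyhedral

variable {E : Type*} [AddCommGroup E] [Module ℝ E] [TopologicalSpace E]
  [ContinuousAdd E] [ContinuousSMul ℝ E]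

lemma tendsto_add_smul_nhdsGT_zero (u w : E) :
    Filter.Tendsto (fun t : ℝ => u + t • w) (nhdsWithin 0 (Set.Ioi 0)) (nhds u) := by
  have h : Continuous fun t : ℝ => u + t • w := by fun_prop
  simpa using (h.tendsto 0).mono_left nhdsWithin_le_nhds

/-- A closed additive subset of a polyhedral cone that is a union of relative interiors of faces
is a face. -/
theorem isExposed_of_saturated (A : Finset (StrongDual ℝ E)) {S : Set E}
    (hSA : ∀ u ∈ S, ∀ a ∈ A, 0 ≤ a u) (hS : IsClosed S) (h0 : 0 ∈ S)
    (hadd : ∀ u ∈ S, ∀ w ∈ S, u + w ∈ S)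
    (hsat : ∀ w ∈ S, ∀ u, (∀ a ∈ A, 0 ≤ a u) → (∀ a ∈ A, a w = 0 ↔ a u = 0) → u ∈ S) :
    IsExposed ℝ {u | ∀ a ∈ A, 0 ≤ a u} S := by
  classical
  intro _
  have hw : ∀ a : StrongDual ℝ E, ∃ w ∈ S, a ∈ A → (∃ u ∈ S, a u ≠ 0) → a w ≠ 0 := by
    intro a
    by_cases h : ∃ u ∈ S, a u ≠ 0
    · obtain ⟨u, hu, hau⟩ := h
      exact ⟨u, hu, fun _ _ => hau⟩
    · exact ⟨0, h0, fun _ h' => absurd h' h⟩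
  choose w hwS hw using hw
  -- The sum is a generic point of `S`: by nonnegativity, a functional in `A` kills it only if it
  -- kills all of `S`.
  have hsumS : ∑ a ∈ A, w a ∈ S :=
    Finset.sum_induction _ (· ∈ S) (fun u v hu hv => hadd u hu v hv) h0 fun a _ => hwS a
  set s := ∑ a ∈ A, w a
  have hs : ∀ a ∈ A, a s = 0 → ∀ u ∈ S, a u = 0 := by
    intro a ha has u hu
    by_contra hau
    rw [map_sum, Finset.sum_eq_zero_iff_of_nonneg fun b _ => hSA _ (hwS b) a ha] at has
    exact hw a ha ⟨u, hu, hau⟩ (has a ha)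
  have hl : ∀ u, (-∑ a ∈ A with a s = 0, a) u = -∑ a ∈ A with a s = 0, a u := fun u => by simp
  refine ⟨-∑ a ∈ A with a s = 0, a, Set.Subset.antisymm ?_ ?_⟩
  · refine fun u hu => ⟨hSA u hu, fun y hy => ?_⟩
    rw [hl, hl, neg_le_neg_iff, Finset.sum_eq_zero fun a ha =>
      hs a (Finset.mem_filter.1 ha).1 (Finset.mem_filter.1 ha).2 u hu]
    exact Finset.sum_nonneg fun a ha => hy a (Finset.mem_filter.1 ha).1
  · rintro u ⟨hu, hmax⟩
    have h1 := hmax 0 (fun a _ => by simp)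
    rw [map_zero, hl, neg_nonneg] at h1
    have h2 := (Finset.sum_eq_zero_iff_of_nonneg
      fun a ha => hu a (Finset.mem_filter.1 ha).1).1
      (le_antisymm h1 (Finset.sum_nonneg fun a ha => hu a (Finset.mem_filter.1 ha).1))
    -- For `t > 0`, `u + t • s` vanishes under the same functionals as `s`, so saturation puts it in
    -- `S`; then `t → 0`.
    refine hS.mem_of_tendsto (tendsto_add_smul_nhdsGT_zero u s) ?_
    filter_upwards [self_mem_nhdsWithin] with t (ht : 0 < t)
    refine hsat s hsumS _ (fun a ha => ?_) fun a ha => ?_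
    · rw [map_add, map_smul, smul_eq_mul]
      exact add_nonneg (hu a ha) (mul_nonneg ht.le (hSA s hsumS a ha))
    · rw [map_add, map_smul, smul_eq_mul]
      constructor
      · intro h
        rw [h2 a (Finset.mem_filter.2 ⟨ha, h⟩), h]
        simp
      · intro h
        have h3 := mul_nonneg ht.le (hSA s hsumS a ha)
        have h4 : t * a s = 0 := by linarith [hu a ha]
        exact (mul_eq_zero.1 h4).resolve_left ht.ne'

end Polyhedral

/-! ### The cones of the Gröbner fan. -/

namespace GroebnerFan

variable {n : ℕ} {k : Type*} [Field k]

/-- The closure of a class inside a polyhedral cone whose relatively open faces are classes. -/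
lemma closedClass_eq {I : Ideal (MvPolynomial (Fin n) k)} {v : Fin n → ℝ}
    {A : Finset (StrongDual ℝ (Fin n → ℝ))} (hv : ∀ a ∈ A, 0 ≤ a v)
    (hA : ∀ u, initialIdeal u I = initialIdeal v I ↔
      (∀ a ∈ A, 0 ≤ a u) ∧ ∀ a ∈ A, a v = 0 ↔ a u = 0) :
    closedClass I v = {u | (∀ a ∈ A, 0 ≤ a u) ∧ ∀ a ∈ A, a v = 0 → a u = 0} := by
  refine Set.Subset.antisymm (closure_minimal ?_ ?_) ?_
  · intro u hu
    obtain ⟨h1, h2⟩ := (hA u).1 hu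
    exact ⟨h1, fun a ha => (h2 a ha).1⟩
  · simp only [Set.ofPred_and, Set.ofPred_forall]
    refine IsClosed.inter ?_ ?_
    · exact isClosed_biInter fun a _ => isClosed_le continuous_const a.continuous
    · exact isClosed_biInter fun a _ => isClosed_iInter fun _ =>
        isClosed_eq a.continuous continuous_const
  · rintro u ⟨h1, h2⟩
    refine mem_closure_of_tendsto (tendsto_add_smul_nhdsGT_zero u v) ?_
    filter_upwards [self_mem_nhdsWithin] with t (ht : 0 < t)
    refine (hA _).2 ⟨fun a ha => ?_, fun a ha => ?_⟩
    · rw [map_add, map_smul, smul_eq_mul]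
      exact add_nonneg (h1 a ha) (mul_nonneg ht.le (hv a ha))
    · rw [map_add, map_smul, smul_eq_mul]
      constructor
      · intro h
        rw [h2 a ha h, h]
        simp
      · intro h
        have h3 := mul_nonneg ht.le (hv a ha)
        have h4 : t * a v = 0 := by linarith [h1 a ha]
        exact (mul_eq_zero.1 h4).resolve_left ht.ne'

/-- A nonempty face of a cone `Q`, exposed by a functional `l`, is cut out by `l = 0`. -/
lemma exists_functional_of_isExposed {Q F : Set (Fin n → ℝ)} (h0 : 0 ∈ Q)
    (hadd : ∀ u ∈ Q, ∀ w ∈ Q, u + w ∈ Q) (hF : IsExposed ℝ Q F) (hne : F.Nonempty) :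
    ∃ l : StrongDual ℝ (Fin n → ℝ), (∀ u ∈ Q, l u ≤ 0) ∧ F = {u ∈ Q | l u = 0} := by
  obtain ⟨l, rfl⟩ := hF hne
  obtain ⟨x, hx, hmax⟩ := hne
  -- Maximality at `x` is tested against `0` and `x + x`.
  have hx0 : l x = 0 := by
    have h1 := hmax 0 h0
    have h2 := hmax _ (hadd x hx x hx)
    simp only [map_zero, map_add] at h1 h2
    linarith
  rw [hx0] at hmax
  refine ⟨l, hmax, Set.Subset.antisymm (fun u hu => ⟨hu.1, ?_⟩) fun u hu => ⟨hu.1, fun y hy => ?_⟩⟩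
  · have h1 := hu.2 x hx
    rw [hx0] at h1
    exact le_antisymm (hmax u hu.1) h1
  · rw [hu.2]
    exact hmax y hy

/-- For `w`, `u` in the polyhedral cone given by `A`, if every functional vanishing at `w` vanishes
at `u`, then `w - t u` stays in the cone for small `t > 0`. -/
lemma exists_pos_sub_smul {E : Type*} [AddCommGroup E] [Module ℝ E] [TopologicalSpace E]
    [ContinuousAdd E] [ContinuousSMul ℝ E] (A : Finset (StrongDual ℝ E)) {w u : E}
    (hw : ∀ a ∈ A, 0 ≤ a w) (h : ∀ a ∈ A, a w = 0 → a u = 0) :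
    ∃ t : ℝ, 0 < t ∧ ∀ a ∈ A, 0 ≤ a (w + t • -u) := by
  have : ∀ᶠ t : ℝ in nhdsWithin 0 (Set.Ioi 0), ∀ a ∈ A, 0 ≤ a (w + t • -u) := by
    refine (Filter.eventually_all_finset A).2 fun a ha => ?_
    rcases (hw a ha).eq_or_lt with h' | h'
    · refine Filter.Eventually.of_forall fun t => ?_
      simp [← h', h a ha h'.symm]
    · have := (a.continuous.tendsto w).comp (tendsto_add_smul_nhdsGT_zero w (-u))
      exact (this.eventually (lt_mem_nhds h')).mono fun t ht => le_of_lt ht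
  obtain ⟨t, h1, h2⟩ := (this.and self_mem_nhdsWithin).exists
  exact ⟨t, h2, h1⟩

/-- The cones of the Gröbner fan are closed additive unions of equivalence classes, contained in
polyhedral cones whose relatively open faces are equivalence classes. -/
theorem exists_of_mem_groebnerFan {I : Ideal (MvPolynomial (Fin n) k)} {F : Set (Fin n → ℝ)}
    (hF : F ∈ groebnerFan I) :
    IsClosed F ∧ 0 ∈ F ∧ (∀ u ∈ F, ∀ w ∈ F, u + w ∈ F) ∧
    (∀ w ∈ F, ∀ u, initialIdeal u I = initialIdeal w I → u ∈ F) ∧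
    ∃ A : Finset (StrongDual ℝ (Fin n → ℝ)), (∀ u ∈ F, ∀ a ∈ A, 0 ≤ a u) ∧
      ∀ w, (∀ a ∈ A, 0 ≤ a w) → ∀ u, initialIdeal u I = initialIdeal w I ↔
        (∀ a ∈ A, 0 ≤ a u) ∧ ∀ a ∈ A, a w = 0 ↔ a u = 0 := by
  obtain ⟨hne, v, hv, hface⟩ := hF
  obtain ⟨A, hvA, hA⟩ := exists_finset_initialIdeal_eq_iff I hv
  have hQ := closedClass_eq hvA (hA v hvA)
  have h0 : 0 ∈ closedClass I v := by
    rw [hQ]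
    exact ⟨fun a _ => by simp, fun a _ _ => by simp⟩
  have hadd : ∀ u ∈ closedClass I v, ∀ w ∈ closedClass I v, u + w ∈ closedClass I v := by
    rw [hQ]
    rintro u ⟨h1, h2⟩ w ⟨h3, h4⟩
    refine ⟨fun a ha => ?_, fun a ha hav => ?_⟩
    · rw [map_add]
      exact add_nonneg (h1 a ha) (h3 a ha)
    · rw [map_add, h2 a ha hav, h4 a ha hav, add_zero]
  refine ⟨hface.isClosed isClosed_closure, ?_⟩
  obtain ⟨l, hl, rfl⟩ := exists_functional_of_isExposed h0 hadd hface hne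
  refine ⟨⟨h0, map_zero l⟩, fun u hu w hw => ⟨hadd u hu.1 w hw.1, ?_⟩, ?_, A, ?_, hA⟩
  · rw [map_add, hu.2, hw.2, add_zero]
  · rintro w ⟨hw, hlw⟩ u hu
    rw [hQ] at hw
    obtain ⟨hu1, hu2⟩ := (hA w hw.1 u).1 hu
    have huQ : u ∈ closedClass I v := by
      rw [hQ]
      exact ⟨hu1, fun a ha hav => (hu2 a ha).1 (hw.2 a ha hav)⟩
    refine ⟨huQ, le_antisymm (hl u huQ) ?_⟩
    -- Since `u` lies in the relatively open face of `w`, the point `w - t u` stays in the closed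
    -- class for small `t`. There `l ≤ 0` while `l w = 0`, forcing `l u ≥ 0`.
    obtain ⟨t, ht, htA⟩ := exists_pos_sub_smul A hw.1 fun a ha => (hu2 a ha).1
    have hmem : w + t • -u ∈ closedClass I v := by
      rw [hQ] at huQ ⊢
      refine ⟨htA, fun a ha hav => ?_⟩
      simp [hw.2 a ha hav, huQ.2 a ha hav]
    have h1 := hl _ hmem
    rw [map_add, map_smul, map_neg, hlw, smul_eq_mul, zero_add, mul_neg, neg_nonpos] at h1
    exact nonneg_of_mul_nonneg_right h1 ht
  · intro u hu
    have hu' := hu.1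
    rw [hQ] at hu'
    exact hu'.1

end GroebnerFan

theorem mainTheorem6 {n : ℕ} {k : Type*} [Field k] (I : Ideal (MvPolynomial (Fin n) k))
    (C₁ C₂ : Set (Fin n → ℝ)) (h₁ : C₁ ∈ GroebnerFan.groebnerFan I)
    (h₂ : C₂ ∈ GroebnerFan.groebnerFan I) :
    GroebnerFan.IsFace C₁ (C₁ ∩ C₂) := by
  obtain ⟨hc₁, h0₁, hadd₁, hsat₁, A, hCA, hA⟩ := GroebnerFan.exists_of_mem_groebnerFan h₁
  obtain ⟨hc₂, h0₂, hadd₂, hsat₂, -⟩ := GroebnerFan.exists_of_mem_groebnerFan h₂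
  -- A face of the polyhedral cone contained in `C₁` is exposed in `C₁` by the same functional.
  refine IsExposed.mono (A := {u | ∀ a ∈ A, 0 ≤ a u}) ?_ hCA Set.inter_subset_left
  refine isExposed_of_saturated A (fun u hu => hCA u hu.1) (hc₁.inter hc₂) ⟨h0₁, h0₂⟩
    (fun u hu w hw => ⟨hadd₁ u hu.1 w hw.1, hadd₂ u hu.2 w hw.2⟩) fun w hw u hu h => ?_
  have huw := (hA w (hCA w hw.1) u).2 ⟨hu, h⟩
  exact ⟨hsat₁ w hw.1 u huw, hsat₂ w hw.2 u huw⟩
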